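/- Let $X$ be a real or complex Hilbert space, let $D: X\supseteq \operatorname{dom} D\to X$ be a closed and densely defined linear operator with adjoint $D^*$, and let $G,R$ be bounded linear operators on $X$. On the Hilbert space $X\times X$ with scalar product $\langle (x_1,x_2),(y_1,y_2)\rangle=\langle x_1,y_1\rangle+\langle x_2,y_2\rangle$ consider the block operator $$A=\begin{bmatrix}-G & -D^*\\ D & -R\end{bmatrix},\qquad \operatorname{dom}A=\operatorname{dom}D\times\operatorname{dom}D^*,\qquad A(x_1,x_2)=(-Gx_1-D^*x_2,\;Dx_1-Rx_2).$$ Then the following holds. (a) If $R=G=0$, then $A$ generates a unitary semigroup, i.e. $A$ is the generator of a strongly continuous semigroup $(T(t))_{t\ge 0}$ on $X\times X$ such that, for every $t\ge 0$, $\|T(t)z\|=\|z\|$ for all $z\in X\times X$ and $T(t)$ is onto. (b) If $\langle Gx,x\rangle\ge 0$ and $\langle Rx,x\rangle\ge 0$ for all $x\in X$, then $A$ generates a contraction semigroup, i.e. $A$ is the generator of a strongly continuous semigroup with $\|T(t)\|\le 1$ for all $t\ge 0$. (c) If there exist $r_0,g_0>0$ such that $\langle Rx,x\rangle\ge r_0\|x\|^2$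 and $\langle Gx,x\rangle\ge g_0\|x\|^2$ for all $x\in X$, then $A$ generates an exponentially stable semigroup, i.e. $A$ is the generator of a strongly continuous semigroup for which there exist $\alpha,M>0$ with $\|T(t)\|\le Me^{-\alpha t}$ for all $t\ge 0$. (Here $\langle Px,x\rangle\ge c$ means that $\langle Px,x\rangle$ is a real number which is at least $c$.) -/

import Mathlib

open scoped NNReal Topology ComplexOrder

/-- A strongly continuous semigroup of bounded linear operators on a normed space. -/
structure C0Semigroup (𝕜 E : Type*) [RCLike 𝕜] [NormedAddCommGroup E] [NormedSpace 𝕜 E] where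
  /-- the operator at time `t ≥ 0` -/
  op : ℝ≥0 → E →L[𝕜] E
  op_zero : op 0 = ContinuousLinearMap.id 𝕜 E
  op_add : ∀ s t : ℝ≥0, op (s + t) = (op s).comp (op t)
  continuous_orbit : ∀ x : E, Continuous (fun t : ℝ≥0 => op t x)

namespace C0Semigroup

variable {𝕜 E : Type*} [RCLike 𝕜] [NormedAddCommGroup E] [NormedSpace 𝕜 E]

/-- The (partially defined) operator `A` is the infinitesimal generator of `T`: a vector `x` is in
the domain of `A` with `A x = y` exactly when `(T t x - x) / t` converges to `y` as `t ↓ 0`. -/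
def IsGeneratedBy (T : C0Semigroup 𝕜 E) (A : E →ₗ.[𝕜] E) : Prop :=
  ∀ x y : E, (x, y) ∈ A.graph ↔
    Filter.Tendsto (fun t : ℝ≥0 => (((t : ℝ)⁻¹ : ℝ) : 𝕜) • (T.op t x - x)) (𝓝[>] 0) (𝓝 y)

/-- Every `T t` is a unitary operator, i.e. norm preserving and onto. -/
def IsUnitary (T : C0Semigroup 𝕜 E) : Prop :=
  ∀ t : ℝ≥0, (∀ x : E, ‖T.op t x‖ = ‖x‖) ∧ Function.Surjective (T.op t)

/-- `‖T t‖ ≤ 1` for all `t ≥ 0`. -/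
def IsContractive (T : C0Semigroup 𝕜 E) : Prop :=
  ∀ t : ℝ≥0, ‖T.op t‖ ≤ 1

/-- `‖T t‖ ≤ M e ^ (-α t)` for all `t ≥ 0`, with some `α, M > 0`. -/
def IsExponentiallyStable (T : C0Semigroup 𝕜 E) : Prop :=
  ∃ α M : ℝ, 0 < α ∧ 0 < M ∧ ∀ t : ℝ≥0, ‖T.op t‖ ≤ M * Real.exp (-α * (t : ℝ))

end C0Semigroup

/-- `⟨P x, x⟩ ≥ 0` for all `x`. The order of `𝕜` is used: the number `⟨P x, x⟩` is real and
nonnegative. -/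
def IsNonnegOp {𝕜 X : Type*} [RCLike 𝕜] [NormedAddCommGroup X] [InnerProductSpace 𝕜 X]
    (P : X →L[𝕜] X) : Prop :=
  ∀ x : X, 0 ≤ inner 𝕜 (P x) x

/-- `⟨P x, x⟩ ≥ c ‖x‖ ^ 2` for all `x`, with some constant `c > 0`. -/
def IsUniformlyPositiveOp {𝕜 X : Type*} [RCLike 𝕜] [NormedAddCommGroup X]
    [InnerProductSpace 𝕜 X] (P : X →L[𝕜] X) : Prop :=
  ∃ c : ℝ, 0 < c ∧ ∀ x : X, ((c * ‖x‖ ^ 2 : ℝ) : 𝕜) ≤ inner 𝕜 (P x) x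

/-- The block operator `[[-G, -D*], [D, -R]]` on the Hilbert space `X × X` (with inner product
`⟨x₁, y₁⟩ + ⟨x₂, y₂⟩`), with domain `dom D × dom D*`. -/
noncomputable def blockOp {𝕜 X : Type*} [RCLike 𝕜] [NormedAddCommGroup X]
    [InnerProductSpace 𝕜 X] [CompleteSpace X]
    (D : X →ₗ.[𝕜] X) (G R : X →L[𝕜] X) : WithLp 2 (X × X) →ₗ.[𝕜] WithLp 2 (X × X) where
  domain :=
    { carrier := {z | z.fst ∈ D.domain ∧ z.snd ∈ D.adjoint.domain}
      add_mem' := fun ha hb => ⟨add_mem ha.1 hb.1, add_mem ha.2 hb.2⟩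
      zero_mem' := ⟨zero_mem _, zero_mem _⟩
      smul_mem' := fun c _ h => ⟨Submodule.smul_mem _ c h.1, Submodule.smul_mem _ c h.2⟩ }
  toFun :=
    { toFun := fun z => WithLp.toLp 2
        (-(G z.1.fst) - D.adjoint ⟨z.1.snd, z.2.2⟩, D ⟨z.1.fst, z.2.1⟩ - R z.1.snd)
      map_add' := fun a b => by
        have h1 := map_add D.toFun ⟨a.1.fst, a.2.1⟩ ⟨b.1.fst, b.2.1⟩
        have h2 := map_add D.adjoint.toFun ⟨a.1.snd, a.2.2⟩ ⟨b.1.snd, b.2.2⟩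
        simp only [LinearPMap.toFun_eq_coe, AddMemClass.mk_add_mk] at h1 h2
        rw [← WithLp.toLp_add]
        congr 1
        ext
        · simp [h2]; abel
        · simp [h1]; abel
      map_smul' := fun c a => by
        have h1 := map_smul D.toFun c ⟨a.1.fst, a.2.1⟩
        have h2 := map_smul D.adjoint.toFun c ⟨a.1.snd, a.2.2⟩
        simp only [LinearPMap.toFun_eq_coe, SetLike.mk_smul_mk] at h1 h2
        rw [RingHom.id_apply, ← WithLp.toLp_smul]
        congr 1
        ext
        · simp [h2, smul_sub]
        · simp [h1, smul_sub] }

/-! Everything rests on the Lumer-Phillips theorem,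
`LinearPMap.IsMDissipative.exists_isGeneratedBy`, proved by Yosida approximation: the bounded
operators `A (1 - l A)⁻¹` commute and generate contractions, whose exponentials converge strongly as
`l → 0`.

The block operator is dissipative because `D` and `-D*` cancel in `Re ⟨A z, z⟩`, leaving only `-G`
and `-R`. The range of `1 - l A` is closed since `A` is closed and dissipative. A vector orthogonal
to it lies in the kernel of `1 - l A*`, where `A*` has the same block shape, so it vanishes by the
same cancellation; here `D** = D` enters. This gives (b).

For (a), flipping the sign of the second component conjugates `A` to `-A`, so both generate
contraction semigroups. These are inverse to each other, hence unitary. For (c), with `c = min g₀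
r₀`, the operator `A + c` is the block operator of `G - c` and `R - c`. By (b) it generates
contractions, and multiplication by `exp (-c t)` recovers `A`. -/

/-! ### Norm bounds for exponentials in a Banach algebra -/

section BanachAlgebra

variable {𝔸 : Type*} [NormedRing 𝔸] [NormedAlgebra ℝ 𝔸] [CompleteSpace 𝔸]

-- The assumption `‖1‖ ≤ 1`, weaker than `‖1‖ = 1`, also covers operators on the zero space.
set_option linter.unusedSectionVars false in
theorem norm_exp_le_exp_norm_of_norm_one_le (h1 : ‖(1 : 𝔸)‖ ≤ 1) (x : 𝔸) :
    ‖NormedSpace.exp x‖ ≤ Real.exp ‖x‖ := by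
  rw [NormedSpace.exp_eq_tsum ℝ, Real.exp_eq_exp_ℝ, NormedSpace.exp_eq_tsum ℝ]
  refine tsum_of_norm_bounded (NormedSpace.expSeries_summable' (𝕂 := ℝ) ‖x‖).hasSum fun n => ?_
  rw [norm_smul, smul_eq_mul, Real.norm_of_nonneg (by positivity)]
  refine mul_le_mul_of_nonneg_left ?_ (by positivity)
  rcases Nat.eq_zero_or_pos n with rfl | hn
  · simpa using h1
  · exact norm_pow_le' x hn

/-- Scalars commute with `J`, so the exponential is `exp (-s)` times `exp (s J)`, and the latter has
norm at most `exp s`. -/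
theorem norm_exp_smul_sub_one_le_one (h1 : ‖(1 : 𝔸)‖ ≤ 1) {J : 𝔸} (hJ : ‖J‖ ≤ 1) {s : ℝ}
    (hs : 0 ≤ s) : ‖NormedSpace.exp (s • (J - 1))‖ ≤ 1 := by
  let : NormedAlgebra ℚ 𝔸 := NormedAlgebra.restrictScalars ℚ ℝ 𝔸
  have h : s • (J - 1) = algebraMap ℝ 𝔸 (-s) + s • J := by
    rw [Algebra.algebraMap_eq_smul_one, smul_sub, neg_smul]; abel
  rw [h, NormedSpace.exp_add_of_commute (Algebra.commutes _ _),
    ← NormedSpace.algebraMap_exp_comm, ← Real.exp_eq_exp_ℝ, ← Algebra.smul_def, norm_smul,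
    Real.norm_of_nonneg (Real.exp_pos _).le]
  calc Real.exp (-s) * ‖NormedSpace.exp (s • J)‖ ≤ Real.exp (-s) * Real.exp s := by
        refine mul_le_mul_of_nonneg_left ?_ (Real.exp_pos _).le
        refine (norm_exp_le_exp_norm_of_norm_one_le h1 _).trans (Real.exp_le_exp.2 ?_)
        rw [norm_smul, Real.norm_of_nonneg hs]
        exact mul_le_of_le_one_right hs hJ
    _ = 1 := by rw [← Real.exp_add]; simp

end BanachAlgebra

/-! ### Exponential groups of bounded operators -/

section ExpSemigroup

variable {𝕜 E : Type*} [RCLike 𝕜] [NormedAddCommGroup E] [NormedSpace 𝕜 E] [CompleteSpace E]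

/-- The uniformly continuous group `exp (t B)` generated by a bounded operator `B`. -/
noncomputable def expGroup (B : E →L[𝕜] E) (t : ℝ) : E →L[𝕜] E :=
  NormedSpace.exp ((t : 𝕜) • B)

set_option linter.unusedSectionVars false in
theorem expGroup_zero (B : E →L[𝕜] E) : expGroup B 0 = 1 := by
  simp [expGroup, NormedSpace.exp_zero]

theorem expGroup_add (B : E →L[𝕜] E) (s t : ℝ) :
    expGroup B (s + t) = expGroup B s * expGroup B t := by
  let : NormedAlgebra ℚ (E →L[𝕜] E) := NormedAlgebra.restrictScalars ℚ 𝕜 _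
  rw [expGroup, RCLike.ofReal_add, add_smul, NormedSpace.exp_add_of_commute]
  · rfl
  · exact ((Commute.refl B).smul_left _).smul_right _

theorem expGroup_sub_of_commute {B C : E →L[𝕜] E} (h : Commute B C) (t : ℝ) :
    expGroup (B - C) t = expGroup B t * expGroup C (-t) := by
  let : NormedAlgebra ℚ (E →L[𝕜] E) := NormedAlgebra.restrictScalars ℚ 𝕜 _
  have : (t : 𝕜) • (B - C) = (t : 𝕜) • B + ((-t : ℝ) : 𝕜) • C := by
    rw [smul_sub, RCLike.ofReal_neg, neg_smul, sub_eq_add_neg]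
  rw [expGroup, this, NormedSpace.exp_add_of_commute]
  · rfl
  · exact (h.smul_left _).smul_right _

set_option linter.unusedSectionVars false in
theorem commute_expGroup {B C : E →L[𝕜] E} (h : Commute B C) (t : ℝ) :
    Commute B (expGroup C t) := by
  let : NormedAlgebra ℚ (E →L[𝕜] E) := NormedAlgebra.restrictScalars ℚ 𝕜 _
  exact (h.smul_right _).exp_right

theorem norm_expGroup_smul_sub_one_le_one {J : E →L[𝕜] E} (hJ : ‖J‖ ≤ 1) {c t : ℝ} (hc : 0 ≤ c)
    (ht : 0 ≤ t) : ‖expGroup ((c : 𝕜) • (J - 1)) t‖ ≤ 1 := by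
  let : NormedAlgebra ℝ (E →L[𝕜] E) := NormedAlgebra.restrictScalars ℝ 𝕜 _
  have h : (t : 𝕜) • (c : 𝕜) • (J - 1) = (t * c) • (J - 1) := by
    rw [smul_smul, ← RCLike.ofReal_mul]; rfl
  rw [expGroup, h]
  exact norm_exp_smul_sub_one_le_one ContinuousLinearMap.norm_id_le hJ (mul_nonneg ht hc)

theorem hasDerivAt_expGroup_apply [NormedSpace ℝ E] [IsScalarTower ℝ 𝕜 E] (B : E →L[𝕜] E) (x : E)
    (t : ℝ) : HasDerivAt (fun s => expGroup B s x) (expGroup B t (B x)) t := by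
  have h1 : HasDerivAt (fun s : 𝕜 => NormedSpace.exp (s • B) x)
      ((NormedSpace.exp ((t : 𝕜) • B) * B) x) (t : 𝕜) :=
    (ContinuousLinearMap.apply 𝕜 E x).hasFDerivAt.comp_hasDerivAt (t : 𝕜)
      (hasDerivAt_exp_smul_const B (t : 𝕜))
  have h2 : HasDerivAt (fun s : ℝ => (s : 𝕜)) 1 t := by
    simpa using (RCLike.ofRealCLM (K := 𝕜)).hasDerivAt (x := t)
  simpa [expGroup, Function.comp_def] using h1.scomp t h2

/-- Mean value inequality along `s ↦ exp (s B) exp ((t - s) C) x`, which joins the two vectors and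
has derivative `exp (s B) exp ((t - s) C) (B x - C x)`. Commutation lets the path be written as `exp
(s (B - C))` applied to a fixed vector. -/
theorem norm_expGroup_sub_expGroup_le {B C : E →L[𝕜] E} (h : Commute B C)
    (hB : ∀ t, 0 ≤ t → ‖expGroup B t‖ ≤ 1) (hC : ∀ t, 0 ≤ t → ‖expGroup C t‖ ≤ 1) {t : ℝ}
    (ht : 0 ≤ t) (x : E) : ‖expGroup B t x - expGroup C t x‖ ≤ t * ‖B x - C x‖ := by
  let : NormedSpace ℝ E := NormedSpace.restrictScalars ℝ 𝕜 E
  have : IsScalarTower ℝ 𝕜 E := ⟨fun a b c => by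
    rw [RCLike.real_smul_eq_coe_mul, mul_smul]; rfl⟩
  have key : ∀ s, expGroup (B - C) s (expGroup C t x) = expGroup B s (expGroup C (t - s) x) := by
    intro s
    rw [expGroup_sub_of_commute h, sub_eq_neg_add, expGroup_add]; rfl
  have hd : Commute (B - C) (expGroup C t) := commute_expGroup (h.sub_left (Commute.refl C)) t
  have key' : ∀ s, expGroup (B - C) s ((B - C) (expGroup C t x)) =
      expGroup B s (expGroup C (t - s) (B x - C x)) := by
    intro s
    rw [show (B - C) (expGroup C t x) = expGroup C t ((B - C) x) from
      congrArg (fun f : E →L[𝕜] E => f x) hd.eq, expGroup_sub_of_commute h, sub_eq_neg_add t,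
      expGroup_add]; rfl
  have := norm_image_sub_le_of_norm_deriv_le_segment' (a := 0) (b := t)
    (f := fun s => expGroup (B - C) s (expGroup C t x)) (C := ‖B x - C x‖)
    (fun s _ => (hasDerivAt_expGroup_apply (B - C) (expGroup C t x) s).hasDerivWithinAt)
    (fun s hs => by
      rw [key']
      refine ((expGroup B s).le_of_opNorm_le (hB s hs.1) _).trans ?_
      rw [one_mul]
      simpa using (expGroup C (t - s)).le_of_opNorm_le (hC _ (sub_nonneg.2 hs.2.le)) (B x - C x))
    t ⟨ht, le_rfl⟩
  simp only [key, sub_self, expGroup_zero, one_apply_eq_self, sub_zero] at this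
  rwa [mul_comm] at this

theorem norm_expGroup_sub_self_le {B : E →L[𝕜] E} (hB : ∀ t, 0 ≤ t → ‖expGroup B t‖ ≤ 1) {t : ℝ}
    (ht : 0 ≤ t) (x : E) : ‖expGroup B t x - x‖ ≤ t * ‖B x‖ := by
  have h0 : ∀ t, expGroup (0 : E →L[𝕜] E) t = 1 := fun t => by
    simp [expGroup, NormedSpace.exp_zero]
  simpa [h0] using norm_expGroup_sub_expGroup_le (Commute.zero_right B) hB
    (fun t _ => by rw [h0]; exact ContinuousLinearMap.norm_id_le) ht x

/-- A Taylor remainder that avoids `B (B x)`: the free vector `z` replaces `B x`, so the bound stays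
controlled along Yosida approximations when `z` lies in the domain of the generator. -/
theorem norm_expGroup_sub_self_sub_smul_le {B : E →L[𝕜] E}
    (hB : ∀ t, 0 ≤ t → ‖expGroup B t‖ ≤ 1) {t : ℝ} (ht : 0 ≤ t) (x z : E) :
    ‖expGroup B t x - x - (t : 𝕜) • B x‖ ≤ t * (2 * ‖B x - z‖ + t * ‖B z‖) := by
  let : NormedSpace ℝ E := NormedSpace.restrictScalars ℝ 𝕜 E
  have : IsScalarTower ℝ 𝕜 E := ⟨fun a b c => by
    rw [RCLike.real_smul_eq_coe_mul, mul_smul]; rfl⟩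
  have := norm_image_sub_le_of_norm_deriv_le_segment' (a := 0) (b := t)
    (f := fun s => expGroup B s x - s • B x) (C := 2 * ‖B x - z‖ + t * ‖B z‖)
    (fun s _ => ((hasDerivAt_expGroup_apply B x s).sub
      ((hasDerivAt_id s).smul_const (B x))).hasDerivWithinAt)
    (fun s hs => by
      have e : expGroup B s (B x) - (1 : ℝ) • B x =
          expGroup B s (B x - z) - (B x - z) + (expGroup B s z - z) := by
        rw [map_sub, one_smul]; abel
      rw [e]
      have h1 := (expGroup B s).le_of_opNorm_le (hB s hs.1) (B x - z)
      have h2 := norm_expGroup_sub_self_le hB hs.1 z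
      have h3 : s * ‖B z‖ ≤ t * ‖B z‖ := mul_le_mul_of_nonneg_right hs.2.le (norm_nonneg _)
      have h4 := norm_add_le (expGroup B s (B x - z) - (B x - z)) (expGroup B s z - z)
      have h5 := norm_sub_le (expGroup B s (B x - z)) (B x - z)
      linarith)
    t ⟨ht, le_rfl⟩
  simp only [expGroup_zero, one_apply_eq_self, sub_zero, zero_smul] at this
  rw [mul_comm]
  refine le_trans (le_of_eq ?_) this
  rw [show (t : 𝕜) • B x = t • B x from rfl]
  congr 1; abel

end ExpSemigroup

open Filter

/-! ### M-dissipative operators and the Lumer-Phillips theorem -/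

section MDissipative

variable {𝕜 E : Type*} [RCLike 𝕜] [NormedAddCommGroup E] [NormedSpace 𝕜 E]

/-- A dissipative operator `A` such that `1 - l A` is onto for all `l > 0`. -/
structure LinearPMap.IsMDissipative (A : E →ₗ.[𝕜] E) : Prop where
  norm_le : ∀ l : ℝ, 0 < l → ∀ x y : E, (x, y) ∈ A.graph → ‖x‖ ≤ ‖x - (l : 𝕜) • y‖
  exists_sub_smul_eq : ∀ l : ℝ, 0 < l → ∀ w : E, ∃ x y : E, (x, y) ∈ A.graph ∧
    x - (l : 𝕜) • y = w

namespace LinearPMap.IsMDissipative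

variable {A : E →ₗ.[𝕜] E}

theorem eq_of_sub_smul_eq (hA : A.IsMDissipative) {l : ℝ} (hl : 0 < l) {x y x' y' : E}
    (h : (x, y) ∈ A.graph) (h' : (x', y') ∈ A.graph)
    (e : x - (l : 𝕜) • y = x' - (l : 𝕜) • y') : x = x' := by
  have := hA.norm_le l hl (x - x') (y - y') (by simpa using A.graph.sub_mem h h')
  have e' : x - x' - (l : 𝕜) • (y - y') = 0 := by
    rw [smul_sub, sub_sub_sub_comm, e, sub_self]
  rw [e', norm_zero] at this
  exact sub_eq_zero.1 (norm_le_zero_iff.1 this)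

/-- Unique solvability of `x - l A x = w` makes the chosen solution linear in `w`; dissipativity
makes it a contraction. -/
theorem exists_resolvent (hA : A.IsMDissipative) {l : ℝ} (hl : 0 < l) :
    ∃ J : E →L[𝕜] E, ‖J‖ ≤ 1 ∧ (∀ x y, (x, y) ∈ A.graph → J (x - (l : 𝕜) • y) = x) ∧
      ∀ w, (J w, ((l⁻¹ : ℝ) : 𝕜) • (J w - w)) ∈ A.graph := by
  choose J y hg he using hA.exists_sub_smul_eq l hl
  have hu : ∀ x y, (x, y) ∈ A.graph → J (x - (l : 𝕜) • y) = x := fun x y h =>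
    hA.eq_of_sub_smul_eq hl (hg _) h (he _)
  have hadd : ∀ v w, J (v + w) = J v + J w := fun v w => by
    rw [← hu (J v + J w) (y v + y w) (by simpa using A.graph.add_mem (hg v) (hg w)), smul_add,
      add_sub_add_comm, he, he]
  have hsmul : ∀ (c : 𝕜) v, J (c • v) = c • J v := fun c v => by
    rw [← hu (c • J v) (c • y v) (by simpa using A.graph.smul_mem c (hg v)), smul_comm,
      ← smul_sub, he]
  refine ⟨LinearMap.mkContinuous ⟨⟨J, hadd⟩, hsmul⟩ 1 fun w => ?_,
    LinearMap.mkContinuous_norm_le _ zero_le_one _, hu, fun w => ?_⟩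
  · have := hA.norm_le l hl _ _ (hg w)
    rw [he] at this
    simpa using this
  · have hl' : (l : 𝕜) ≠ 0 := RCLike.ofReal_ne_zero.2 hl.ne'
    have : ((l⁻¹ : ℝ) : 𝕜) • (J w - w) = y w := by
      nth_rw 2 [← he w]
      rw [sub_sub_cancel, RCLike.ofReal_inv, inv_smul_smul₀ hl']
    change (J w, ((l⁻¹ : ℝ) : 𝕜) • (J w - w)) ∈ A.graph
    rw [this]
    exact hg w

/-- The Yosida approximations of an m-dissipative operator. -/
theorem exists_yosida [CompleteSpace E] (hA : A.IsMDissipative) (hd : Dense (A.domain : Set E)) :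
    ∃ B : ℕ → E →L[𝕜] E, (∀ m n, Commute (B m) (B n)) ∧
      (∀ n t, 0 ≤ t → ‖expGroup (B n) t‖ ≤ 1) ∧
      ∀ x y, (x, y) ∈ A.graph → Tendsto (fun n => B n x) atTop (𝓝 y) := by
  have hpos : ∀ n : ℕ, (0 : ℝ) < 1 / ((n : ℝ) + 1) := fun n => Nat.one_div_pos_of_nat
  have hne : ∀ n : ℕ, ((1 / ((n : ℝ) + 1) : ℝ) : 𝕜) ≠ 0 := fun n =>
    RCLike.ofReal_ne_zero.2 (hpos n).ne'
  choose J hJ hJl hJr using fun n : ℕ => hA.exists_resolvent (hpos n)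
  -- With `l = 1 / (n + 1)`, the resolvent `J` commutes with `A` on the domain: `J x - x = l J (A
  -- x)`.
  have hY : ∀ n x y, (x, y) ∈ A.graph →
      J n x - x = ((1 / ((n : ℝ) + 1) : ℝ) : 𝕜) • J n y := by
    intro n x y h
    have := hJl n x y h
    rw [_root_.map_sub, _root_.map_smul] at this
    nth_rw 2 [← this]
    rw [sub_sub_cancel]
  have hgraph : ∀ n x y, (x, y) ∈ A.graph → (J n x, J n y) ∈ A.graph := by
    intro n x y h
    have := hJr n x
    rwa [hY n x y h, RCLike.ofReal_inv, inv_smul_smul₀ (hne n)] at this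
  have hcomm : ∀ m n, Commute (J m) (J n) := by
    intro m n
    ext w
    have h1 := hJr n w
    have h2 := hJl n _ _ (hgraph m _ _ h1)
    rw [← _root_.map_smul, ← _root_.map_sub, RCLike.ofReal_inv, smul_inv_smul₀ (hne n), sub_sub_cancel] at h2
    exact h2.symm
  -- On the domain the error is `l J y`, of norm at most `l ‖y‖`; density and `‖J‖ ≤ 1` give the
  -- rest.
  have hconv : ∀ x, Tendsto (fun n => J n x) atTop (𝓝 x) := by
    intro x
    rw [Metric.tendsto_atTop]
    intro ε hε
    obtain ⟨z, hz, hxz⟩ := Metric.dense_iff.1 hd x (ε / 4) (by positivity)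
    obtain ⟨y, hy⟩ := LinearPMap.mem_domain_iff.1 hxz
    have ht : Tendsto (fun n : ℕ => 1 / ((n : ℝ) + 1) * ‖y‖) atTop (𝓝 0) := by
      simpa using (tendsto_one_div_add_atTop_nhds_zero_nat (𝕜 := ℝ)).mul_const ‖y‖
    obtain ⟨N, hN⟩ := eventually_atTop.1 (ht.eventually (gt_mem_nhds (half_pos hε)))
    refine ⟨N, fun n hn => ?_⟩
    have e : J n x - x = J n (x - z) - (x - z) + (J n z - z) := by rw [_root_.map_sub]; abel
    rw [dist_eq_norm, e, hY n z y hy]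
    have h1 := (J n).le_of_opNorm_le (hJ n) (x - z)
    have h2 := (J n).le_of_opNorm_le (hJ n) y
    have h3 : ‖x - z‖ < ε / 4 := by rw [← dist_eq_norm, dist_comm]; exact hz
    have h4 := norm_add_le (J n (x - z) - (x - z)) (((1 / ((n : ℝ) + 1) : ℝ) : 𝕜) • J n y)
    have h5 := norm_sub_le (J n (x - z)) (x - z)
    rw [norm_smul, RCLike.norm_ofReal, abs_of_pos (hpos n)] at h4
    have h6 : 1 / ((n : ℝ) + 1) * ‖J n y‖ ≤ 1 / ((n : ℝ) + 1) * ‖y‖ :=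
      mul_le_mul_of_nonneg_left (by linarith) (hpos n).le
    have h7 := hN n hn
    linarith
  -- The Yosida approximation `l⁻¹ (J - 1)` sends a domain vector `x` to `J (A x)`, which tends to
  -- `A x`.
  refine ⟨fun n => (((1 / ((n : ℝ) + 1))⁻¹ : ℝ) : 𝕜) • (J n - 1), fun m n => ?_, fun n t ht => ?_,
    fun x y h => ?_⟩
  · exact ((((hcomm m n).sub_left (Commute.one_left _)).sub_right
      (Commute.one_right _)).smul_left _).smul_right _
  · exact norm_expGroup_smul_sub_one_le_one (hJ n) (inv_nonneg.2 (hpos n).le) ht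
  · refine (hconv y).congr fun n => ?_
    change _ = (((1 / ((n : ℝ) + 1))⁻¹ : ℝ) : 𝕜) • (J n x - x)
    rw [hY n x y h, RCLike.ofReal_inv, inv_smul_smul₀ (hne n)]

end LinearPMap.IsMDissipative

/-- On the domain, `norm_expGroup_sub_expGroup_le` makes the exponentials Cauchy; uniform
contractivity extends this to the whole space by density. -/
theorem exists_contraction_semigroup_of_yosida [CompleteSpace E] {A : E →ₗ.[𝕜] E}
    (hd : Dense (A.domain : Set E)) {B : ℕ → E →L[𝕜] E} (hcomm : ∀ m n, Commute (B m) (B n))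
    (hB : ∀ n t, 0 ≤ t → ‖expGroup (B n) t‖ ≤ 1)
    (hlim : ∀ x y, (x, y) ∈ A.graph → Tendsto (fun n => B n x) atTop (𝓝 y)) :
    ∃ T : C0Semigroup 𝕜 E, T.IsContractive ∧
      ∀ (t : ℝ≥0) (x : E), Tendsto (fun n => expGroup (B n) t x) atTop (𝓝 (T.op t x)) := by
  have hle : ∀ n (t : ℝ≥0) x, ‖expGroup (B n) t x‖ ≤ ‖x‖ := fun n t x => by
    simpa using (expGroup (B n) t).le_of_opNorm_le (hB n t t.2) x
  have happrox : ∀ (x : E) {ε : ℝ}, 0 < ε → ∃ z y, (z, y) ∈ A.graph ∧ ‖x - z‖ < ε := by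
    intro x ε hε
    obtain ⟨z, hz, hxz⟩ := Metric.dense_iff.1 hd x ε hε
    obtain ⟨y, hy⟩ := LinearPMap.mem_domain_iff.1 hxz
    exact ⟨z, y, hy, by rw [← dist_eq_norm, dist_comm]; exact hz⟩
  have hex : ∀ (t : ℝ≥0) (x : E), ∃ y, Tendsto (fun n => expGroup (B n) t x) atTop (𝓝 y) := by
    intro t x
    refine cauchySeq_tendsto_of_complete (Metric.cauchySeq_iff.2 fun ε hε => ?_)
    obtain ⟨z, y, hzy, hz⟩ := happrox x (ε := ε / 4) (by positivity)
    have hc := (hlim z y hzy).cauchySeq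
    -- Multiplication by `t` leaves at most `ε / 2`; the `+ 1` covers `t = 0`.
    obtain ⟨N, hN⟩ := Metric.cauchySeq_iff.1 hc (ε / (2 * ((t : ℝ) + 1))) (by positivity)
    refine ⟨N, fun m hm n hn => ?_⟩
    have e : expGroup (B m) t x - expGroup (B n) t x = expGroup (B m) t (x - z)
        - expGroup (B n) t (x - z) + (expGroup (B m) t z - expGroup (B n) t z) := by
      simp only [_root_.map_sub]; abel
    have h1 := hN m hm n hn
    rw [dist_eq_norm] at h1 ⊢
    rw [lt_div_iff₀ (by positivity)] at h1
    rw [e]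
    have h2 := norm_expGroup_sub_expGroup_le (hcomm m n) (hB m) (hB n) t.coe_nonneg z
    have h3 := hle m t (x - z)
    have h4 := hle n t (x - z)
    have h5 := norm_add_le (expGroup (B m) t (x - z) - expGroup (B n) t (x - z))
      (expGroup (B m) t z - expGroup (B n) t z)
    have h6 := norm_sub_le (expGroup (B m) t (x - z)) (expGroup (B n) t (x - z))
    have h7 := norm_nonneg (B m z - B n z)
    linarith
  choose f hf using hex
  have hfle : ∀ t x, ‖f t x‖ ≤ 1 * ‖x‖ := fun t x => by
    rw [one_mul]
    exact le_of_tendsto (hf t x).norm (Eventually.of_forall fun n => hle n t x)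
  have hfadd : ∀ t x y, f t (x + y) = f t x + f t y := fun t x y =>
    tendsto_nhds_unique (hf t (x + y)) (by simpa using (hf t x).add (hf t y))
  have hfsmul : ∀ t (c : 𝕜) x, f t (c • x) = c • f t x := fun t c x =>
    tendsto_nhds_unique (hf t (c • x)) (by simpa using (hf t x).const_smul c)
  have hlip : ∀ z y, (z, y) ∈ A.graph → ∀ s t : ℝ≥0, s ≤ t →
      ‖f t z - f s z‖ ≤ ((t : ℝ) - s) * ‖y‖ := by
    intro z y hzy s t hst
    refine le_of_tendsto_of_tendsto ((hf t z).sub (hf s z)).norm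
      ((hlim z y hzy).norm.const_mul ((t : ℝ) - s)) (Eventually.of_forall fun n => ?_)
    have hst' : (0 : ℝ) ≤ t - s := sub_nonneg.2 (NNReal.coe_le_coe.2 hst)
    have e : expGroup (B n) t z - expGroup (B n) s z =
        expGroup (B n) s (expGroup (B n) (t - s) z - z) := by
      have := expGroup_add (B n) s (t - s)
      rw [add_sub_cancel] at this
      rw [_root_.map_sub, this]; rfl
    dsimp only
    rw [e]
    exact (hle n s _).trans (norm_expGroup_sub_self_le (hB n) hst' z)
  have hlip' : ∀ z y, (z, y) ∈ A.graph → Continuous fun t => f t z := by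
    intro z y hzy
    refine (LipschitzWith.of_dist_le_mul (K := ‖y‖₊) fun t s => ?_).continuous
    rcases le_total s t with h | h
    · have := hlip z y hzy s t h
      rw [dist_eq_norm, NNReal.dist_eq, abs_of_nonneg (sub_nonneg.2 (NNReal.coe_le_coe.2 h)),
        mul_comm]
      exact this
    · have := hlip z y hzy t s h
      rw [dist_comm, dist_comm t, dist_eq_norm, NNReal.dist_eq,
        abs_of_nonneg (sub_nonneg.2 (NNReal.coe_le_coe.2 h)), mul_comm]
      exact this
  refine ⟨⟨fun t => LinearMap.mkContinuous ⟨⟨f t, hfadd t⟩, hfsmul t⟩ 1 (hfle t), ?_, ?_, ?_⟩,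
    fun t => LinearMap.mkContinuous_norm_le _ zero_le_one (hfle t), hf⟩
  · ext x
    refine tendsto_nhds_unique (hf 0 x) ?_
    simp [expGroup_zero]
  · intro s t
    ext x
    refine tendsto_nhds_unique (hf (s + t) x) ?_
    change Tendsto _ _ (𝓝 (f s (f t x)))
    have h1 : Tendsto (fun n => expGroup (B n) s (expGroup (B n) t x - f t x)) atTop (𝓝 0) := by
      refine squeeze_zero_norm (fun n => hle n s _) ?_
      simpa using ((hf t x).sub_const (f t x)).norm
    refine (by simpa using h1.add (hf s (f t x)) : Tendsto _ _ _).congr fun n => ?_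
    rw [NNReal.coe_add, expGroup_add]
    simp
  · intro x
    change Continuous fun t => f t x
    -- Orbits of domain vectors are Lipschitz, and by contractivity they approximate every orbit
    -- uniformly in time.
    refine continuous_of_uniform_approx_of_continuous fun u hu => ?_
    obtain ⟨ε, hε, hu⟩ := Metric.mem_uniformity_dist.1 hu
    obtain ⟨z, y, hzy, hz⟩ := happrox x hε
    refine ⟨fun t => f t z, hlip' z y hzy, fun t => hu ?_⟩
    have e : f t x - f t z = f t (x - z) := by
      have := hfadd t (x - z) z
      rw [sub_add_cancel] at this
      rw [this, add_sub_cancel_right]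
    rw [dist_eq_norm, e]
    have := hfle t (x - z)
    linarith

namespace C0Semigroup

theorem norm_op_apply_le {T : C0Semigroup 𝕜 E} (hT : T.IsContractive) (t : ℝ≥0) (x : E) :
    ‖T.op t x‖ ≤ ‖x‖ := by
  simpa using (T.op t).le_of_opNorm_le (hT t) x

theorem norm_inv_smul (t : ℝ≥0) (x : E) :
    ‖(((t : ℝ)⁻¹ : ℝ) : 𝕜) • x‖ = (t : ℝ)⁻¹ * ‖x‖ := by
  rw [norm_smul, RCLike.norm_ofReal, abs_of_nonneg (inv_nonneg.2 t.coe_nonneg)]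

/-- A fixed point of the generator of a contraction semigroup is zero. -/
theorem eq_zero_of_tendsto_self {T : C0Semigroup 𝕜 E} (hT : T.IsContractive) {u : E}
    (h : Tendsto (fun t : ℝ≥0 => (((t : ℝ)⁻¹ : ℝ) : 𝕜) • (T.op t u - u)) (𝓝[>] 0) (𝓝 u)) :
    u = 0 := by
  have h0 : Tendsto (fun t : ℝ≥0 => ‖(((t : ℝ)⁻¹ : ℝ) : 𝕜) • (T.op t u - u) - u‖)
      (𝓝[>] 0) (𝓝 0) := by simpa using (h.sub_const u).norm
  refine norm_le_zero_iff.1 (ge_of_tendsto h0 ?_)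
  filter_upwards [self_mem_nhdsWithin] with t ht
  have ht' : (0 : ℝ) < t := NNReal.coe_pos.2 ht
  have htk : ((t : ℝ) : 𝕜) ≠ 0 := RCLike.ofReal_ne_zero.2 ht'.ne'
  set r := (((t : ℝ)⁻¹ : ℝ) : 𝕜) • (T.op t u - u) - u with hr
  -- Taking norms gives `(1 + t) ‖u‖ ≤ ‖u‖ + t ‖r‖`, so `‖u‖ ≤ ‖r‖`, and `r` tends to zero.
  have e : ((1 + t : ℝ) : 𝕜) • u = T.op t u - ((t : ℝ) : 𝕜) • r := by
    rw [hr, smul_sub, RCLike.ofReal_inv, smul_inv_smul₀ htk, RCLike.ofReal_add, add_smul,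
      RCLike.ofReal_one, one_smul]
    abel
  have h1 := congrArg norm e
  rw [norm_smul, RCLike.norm_ofReal, abs_of_pos (by positivity)] at h1
  have h2 := norm_sub_le (T.op t u) (((t : ℝ) : 𝕜) • r)
  rw [norm_smul, RCLike.norm_ofReal, abs_of_pos ht'] at h2
  have h3 := norm_op_apply_le hT t u
  have h4 : (t : ℝ) * ‖u‖ ≤ t * ‖r‖ := by linarith
  exact le_of_mul_le_mul_left h4 ht'

/-- The generator of `T` cannot properly extend `A`: `1 - A` is already onto, while `1` minus the
generator is injective by `eq_zero_of_tendsto_self`. -/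
theorem isGeneratedBy_of_forall_mem_graph {T : C0Semigroup 𝕜 E} (hT : T.IsContractive)
    {A : E →ₗ.[𝕜] E} (hA : A.IsMDissipative)
    (h : ∀ x y, (x, y) ∈ A.graph →
      Tendsto (fun t : ℝ≥0 => (((t : ℝ)⁻¹ : ℝ) : 𝕜) • (T.op t x - x)) (𝓝[>] 0) (𝓝 y)) :
    T.IsGeneratedBy A := by
  refine fun x y => ⟨h x y, fun hxy => ?_⟩
  obtain ⟨x', y', hg, he⟩ := hA.exists_sub_smul_eq 1 one_pos (x - y)
  rw [RCLike.ofReal_one, one_smul] at he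
  have hu : x - x' = y - y' := by
    rw [sub_eq_sub_iff_sub_eq_sub]; exact he.symm
  have h0 : x - x' = 0 := by
    refine eq_zero_of_tendsto_self hT ?_
    nth_rw 3 [hu]
    refine (hxy.sub (h x' y' hg)).congr fun t => ?_
    rw [← smul_sub, _root_.map_sub]
    congr 1; abel
  rw [h0] at hu
  rw [sub_eq_zero.1 h0, sub_eq_zero.1 hu.symm]
  exact hg

end C0Semigroup

/-- The **Lumer-Phillips theorem**. -/
theorem LinearPMap.IsMDissipative.exists_isGeneratedBy [CompleteSpace E] {A : E →ₗ.[𝕜] E}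
    (hA : A.IsMDissipative) (hd : Dense (A.domain : Set E)) :
    ∃ T : C0Semigroup 𝕜 E, T.IsGeneratedBy A ∧ T.IsContractive := by
  obtain ⟨B, hcomm, hB, hlim⟩ := hA.exists_yosida hd
  obtain ⟨T, hT, hTlim⟩ := exists_contraction_semigroup_of_yosida hd hcomm hB hlim
  refine ⟨T, C0Semigroup.isGeneratedBy_of_forall_mem_graph hT hA fun x y hxy => ?_, hT⟩
  have key : ∀ z w, (z, w) ∈ A.graph → ∀ t : ℝ≥0,
      ‖T.op t x - x - ((t : ℝ) : 𝕜) • y‖ ≤ t * (2 * ‖y - z‖ + t * ‖w‖) := by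
    intro z w hzw t
    refine le_of_tendsto_of_tendsto
      (((hTlim t x).sub_const x).sub ((hlim x y hxy).const_smul ((t : ℝ) : 𝕜))).norm
      ((((((hlim x y hxy).sub_const z).norm.const_mul 2).add
        ((hlim z w hzw).norm.const_mul (t : ℝ)))).const_mul (t : ℝ))
      (Eventually.of_forall fun n => ?_)
    exact norm_expGroup_sub_self_sub_smul_le (hB n) t.2 x z
  rw [Metric.tendsto_nhds]
  intro ε hε
  -- `y = A x` need not lie in the domain, so it is replaced by a nearby `z` that does.
  obtain ⟨z, hz, hyz⟩ := Metric.dense_iff.1 hd y (ε / 4) (by positivity)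
  obtain ⟨w, hw⟩ := LinearPMap.mem_domain_iff.1 hyz
  have hz' : ‖y - z‖ < ε / 4 := by rw [← dist_eq_norm, dist_comm]; exact hz
  have ht : Tendsto (fun t : ℝ≥0 => (t : ℝ) * ‖w‖) (𝓝[>] 0) (𝓝 0) := by
    have : Continuous fun t : ℝ≥0 => (t : ℝ) * ‖w‖ := by fun_prop
    simpa using (this.tendsto 0).mono_left nhdsWithin_le_nhds
  filter_upwards [self_mem_nhdsWithin, ht.eventually (gt_mem_nhds (half_pos hε))] with t ht0 ht1
  have ht' : (0 : ℝ) < t := NNReal.coe_pos.2 ht0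
  have htk : ((t : ℝ) : 𝕜) ≠ 0 := RCLike.ofReal_ne_zero.2 ht'.ne'
  have e : (((t : ℝ)⁻¹ : ℝ) : 𝕜) • (T.op t x - x) - y =
      (((t : ℝ)⁻¹ : ℝ) : 𝕜) • (T.op t x - x - ((t : ℝ) : 𝕜) • y) := by
    rw [smul_sub _ (T.op t x - x), RCLike.ofReal_inv, inv_smul_smul₀ htk]
  rw [dist_eq_norm, e, C0Semigroup.norm_inv_smul, inv_mul_lt_iff₀ ht']
  refine (key z w hw t).trans_lt (mul_lt_mul_of_pos_left ?_ ht')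
  linarith

end MDissipative

/-! ### Inverse semigroups and rescaling -/

namespace C0Semigroup

variable {𝕜 E : Type*} [RCLike 𝕜] [NormedAddCommGroup E] [NormedSpace 𝕜 E]

theorem tendsto_op_apply {T : C0Semigroup 𝕜 E} (hT : T.IsContractive) {α : Type*} {l : Filter α}
    {τ : α → ℝ≥0} {g : α → E} {t : ℝ≥0} {w : E} (hτ : Tendsto τ l (𝓝 t))
    (hg : Tendsto g l (𝓝 w)) : Tendsto (fun a => T.op (τ a) (g a)) l (𝓝 (T.op t w)) := by
  have h1 : Tendsto (fun a => T.op (τ a) (g a - w)) l (𝓝 0) := by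
    refine squeeze_zero_norm (fun a => norm_op_apply_le hT _ _) ?_
    simpa using (hg.sub_const w).norm
  have h2 := h1.add (((T.continuous_orbit w).tendsto t).comp hτ)
  rw [zero_add] at h2
  refine h2.congr fun a => ?_
  simp

/-- The semigroup maps the domain of its generator to itself and commutes with the generator. -/
theorem IsGeneratedBy.op_mem_graph {T : C0Semigroup 𝕜 E} {A : E →ₗ.[𝕜] E} (hT : T.IsGeneratedBy A)
    {x y : E} (h : (x, y) ∈ A.graph) (t : ℝ≥0) : (T.op t x, T.op t y) ∈ A.graph := by
  refine (hT _ _).2 ((((T.op t).continuous.tendsto y).comp ((hT x y).1 h)).congr fun s => ?_)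
  have e : T.op t (T.op s x) = T.op s (T.op t x) := by
    have h1 := T.op_add t s
    rw [add_comm, T.op_add s t] at h1
    exact congrArg (fun f : E →L[𝕜] E => f x) h1.symm
  simp only [Function.comp_apply, _root_.map_smul, _root_.map_sub, e]

/-- Contraction semigroups generated by `A` and `-A` are inverse to each other. -/
theorem op_comp_op_of_neg {T S : C0Semigroup 𝕜 E} (hTc : T.IsContractive)
    {A A' : E →ₗ.[𝕜] E} (hT : T.IsGeneratedBy A) (hS : S.IsGeneratedBy A')
    (hA : ∀ x y, (x, y) ∈ A'.graph → (x, -y) ∈ A.graph) (hd : Dense (A'.domain : Set E))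
    (t : ℝ≥0) (x : E) : T.op t (S.op t x) = x := by
  let : NormedSpace ℝ E := NormedSpace.restrictScalars ℝ 𝕜 E
  -- Product rule at time zero: the contributions `y` of `S` and `-y` of `T` cancel.
  have hzero : ∀ x y, (x, y) ∈ A'.graph →
      Tendsto (fun t : ℝ≥0 => (((t : ℝ)⁻¹ : ℝ) : 𝕜) • (T.op t (S.op t x) - x)) (𝓝[>] 0) (𝓝 0) := by
    intro x y h
    have h1 := (hS x y).1 h
    have h2 := (hT x (-y)).1 (hA x y h)
    have h3 : Tendsto (fun t : ℝ≥0 => t) (𝓝[>] 0) (𝓝 0) := nhdsWithin_le_nhds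
    have h4 := (tendsto_op_apply hTc h3 h1).add h2
    rw [T.op_zero, ContinuousLinearMap.id_apply, add_neg_cancel] at h4
    refine h4.congr fun s => ?_
    rw [_root_.map_smul, ← smul_add, _root_.map_sub, sub_add_sub_cancel]
  have hcont : ∀ x, Continuous fun s : ℝ≥0 => T.op s (S.op s x) := fun x =>
    continuous_iff_continuousAt.2 fun s =>
      tendsto_op_apply hTc tendsto_id ((S.continuous_orbit x).tendsto s)
  have hdom : ∀ x y, (x, y) ∈ A'.graph → T.op t (S.op t x) = x := by
    intro x y h
    -- The right derivative at `s` reduces to the one at zero, taken at `S s x`, which stays in the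
    -- domain, and then mapped by `T s`.
    have := constant_of_has_deriv_right_zero (a := 0) (b := (t : ℝ))
      (f := fun s : ℝ => T.op s.toNNReal (S.op s.toNNReal x))
      ((hcont x).comp continuous_real_toNNReal).continuousOn
      (fun s hs => by
        rw [← hasDerivWithinAt_Ioi_iff_Ici, hasDerivWithinAt_iff_tendsto_slope' (by simp)]
        have hh : Tendsto (fun u : ℝ => (u - s).toNNReal) (𝓝[>] s) (𝓝[>] 0) := by
          refine tendsto_nhdsWithin_iff.2 ⟨?_, ?_⟩
          · have : Continuous fun u : ℝ => (u - s).toNNReal := by fun_prop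
            simpa using (this.tendsto s).mono_left nhdsWithin_le_nhds
          · filter_upwards [self_mem_nhdsWithin] with u hu
            exact Real.toNNReal_pos.2 (sub_pos.2 hu)
        have h1 := ((T.op s.toNNReal).continuous.tendsto 0).comp
          ((hzero _ _ (hS.op_mem_graph h s.toNNReal)).comp hh)
        rw [_root_.map_zero] at h1
        refine h1.congr' ?_
        filter_upwards [self_mem_nhdsWithin] with u hu
        have hus : 0 ≤ u - s := (sub_pos.2 hu).le
        have e1 : u.toNNReal = s.toNNReal + (u - s).toNNReal := by
          rw [← Real.toNNReal_add hs.1 hus, add_sub_cancel]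
        have e2 : T.op u.toNNReal (S.op u.toNNReal x) = T.op s.toNNReal
            (T.op (u - s).toNNReal (S.op (u - s).toNNReal (S.op s.toNNReal x))) := by
          rw [e1, T.op_add]
          rw [add_comm, S.op_add]
          rfl
        simp only [slope_def_module, e2, Function.comp_apply, _root_.map_smul, _root_.map_sub,
          Real.coe_toNNReal _ hus]
        rfl) t ⟨t.coe_nonneg, le_rfl⟩
    simpa [T.op_zero, S.op_zero] using this
  have hclosed : IsClosed {x | T.op t (S.op t x) = x} :=
    isClosed_eq ((T.op t).continuous.comp (S.op t).continuous) continuous_id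
  refine hclosed.closure_subset_iff.2 (fun z hz => ?_) (hd x)
  obtain ⟨y, hy⟩ := LinearPMap.mem_domain_iff.1 hz
  exact hdom z y hy

/-- A contraction with a contractive two-sided inverse is isometric and onto. -/
theorem isUnitary_of_neg {T S : C0Semigroup 𝕜 E} (hTc : T.IsContractive) (hSc : S.IsContractive)
    {A A' : E →ₗ.[𝕜] E} (hT : T.IsGeneratedBy A) (hS : S.IsGeneratedBy A')
    (hA : ∀ x y, (x, y) ∈ A'.graph ↔ (x, -y) ∈ A.graph) (hd : Dense (A.domain : Set E)) :
    T.IsUnitary := by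
  have hA' : ∀ x y, (x, y) ∈ A.graph → (x, -y) ∈ A'.graph := fun x y h =>
    (hA x (-y)).2 (by rwa [neg_neg])
  have hdom : (A.domain : Set E) ⊆ A'.domain := fun x hx => by
    obtain ⟨y, hy⟩ := LinearPMap.mem_domain_iff.1 hx
    exact LinearPMap.mem_domain_of_mem_graph (hA' x y hy)
  refine fun t => ⟨fun x => le_antisymm (norm_op_apply_le hTc t x) ?_, fun x => ⟨S.op t x, ?_⟩⟩
  · have := norm_op_apply_le hSc t (T.op t x)
    rwa [op_comp_op_of_neg hSc hS hT hA' hd] at this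
  · exact op_comp_op_of_neg hTc hT hS (fun x y h => (hA x y).1 h) (hd.mono hdom) t x

/-- The rescaled semigroup `exp (a t) T t`. -/
noncomputable def rescale (T : C0Semigroup 𝕜 E) (a : ℝ) : C0Semigroup 𝕜 E where
  op t := ((Real.exp (a * t) : ℝ) : 𝕜) • T.op t
  op_zero := by simp [T.op_zero]
  op_add s t := by
    rw [NNReal.coe_add, mul_add, Real.exp_add, T.op_add, RCLike.ofReal_mul, mul_smul]
    ext x
    change ((Real.exp (a * s) : ℝ) : 𝕜) • ((Real.exp (a * t) : ℝ) : 𝕜) • T.op s (T.op t x) =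
      ((Real.exp (a * s) : ℝ) : 𝕜) • T.op s (((Real.exp (a * t) : ℝ) : 𝕜) • T.op t x)
    rw [_root_.map_smul]
  continuous_orbit x := by
    have h : Continuous fun t : ℝ≥0 => ((Real.exp (a * t) : ℝ) : 𝕜) :=
      RCLike.continuous_ofReal.comp (by fun_prop)
    exact h.smul (T.continuous_orbit x)

theorem tendsto_inv_smul_exp_smul_sub {f : ℝ≥0 → E} {x y : E} (a : ℝ)
    (hf : Tendsto (fun t : ℝ≥0 => (((t : ℝ)⁻¹ : ℝ) : 𝕜) • (f t - x)) (𝓝[>] 0) (𝓝 y)) :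
    Tendsto (fun t : ℝ≥0 => (((t : ℝ)⁻¹ : ℝ) : 𝕜) • (((Real.exp (a * t) : ℝ) : 𝕜) • f t - x))
      (𝓝[>] 0) (𝓝 (y + (a : 𝕜) • x)) := by
  have h1 : Tendsto (fun t : ℝ≥0 => ((Real.exp (a * t) : ℝ) : 𝕜)) (𝓝[>] 0) (𝓝 1) := by
    have h : Continuous fun t : ℝ≥0 => ((Real.exp (a * t) : ℝ) : 𝕜) :=
      RCLike.continuous_ofReal.comp (by fun_prop)
    simpa using (h.tendsto 0).mono_left nhdsWithin_le_nhds
  have hcoe : Tendsto (fun t : ℝ≥0 => (t : ℝ)) (𝓝[>] 0) (𝓝[≠] 0) := by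
    refine tendsto_nhdsWithin_iff.2 ⟨?_, ?_⟩
    · simpa using (NNReal.continuous_coe.tendsto 0).mono_left nhdsWithin_le_nhds
    · filter_upwards [self_mem_nhdsWithin] with t ht
      exact (NNReal.coe_pos.2 ht).ne'
  have h2 : Tendsto (fun t : ℝ≥0 => (t : ℝ)⁻¹ * (Real.exp (a * t) - 1)) (𝓝[>] 0) (𝓝 a) := by
    have hd : HasDerivAt (fun t : ℝ => Real.exp (a * t)) a 0 := by
      simpa using ((hasDerivAt_id (0 : ℝ)).const_mul a).exp
    refine ((hasDerivAt_iff_tendsto_slope.1 hd).comp hcoe).congr fun t => ?_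
    simp [slope_def_field, div_eq_inv_mul]
  have h3 := (h1.smul hf).add
    (((RCLike.continuous_ofReal (K := 𝕜)).tendsto a).comp h2 |>.smul_const x)
  rw [one_smul] at h3
  refine h3.congr fun t => ?_
  simp only [Function.comp_apply, RCLike.ofReal_mul, RCLike.ofReal_sub, RCLike.ofReal_one]
  rw [smul_comm, mul_smul, ← smul_add, smul_sub, sub_smul, one_smul, sub_add_sub_cancel]

theorem IsGeneratedBy.rescale {T : C0Semigroup 𝕜 E} {A A' : E →ₗ.[𝕜] E} (hT : T.IsGeneratedBy A)
    (a : ℝ) (h : ∀ x y, (x, y) ∈ A'.graph ↔ (x, y - (a : 𝕜) • x) ∈ A.graph) :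
    (T.rescale a).IsGeneratedBy A' := by
  intro x y
  rw [h, hT]
  refine ⟨fun H => ?_, fun H => ?_⟩
  · simpa using! tendsto_inv_smul_exp_smul_sub a H
  -- The converse undoes the rescaling with the factor `exp (-a t)`.
  · have := tendsto_inv_smul_exp_smul_sub (-a) H
    rw [RCLike.ofReal_neg, neg_smul, ← sub_eq_add_neg] at this
    refine this.congr fun t => ?_
    change _ • (_ • ((Real.exp (a * t) : ℝ) : 𝕜) • T.op t x - x) = _
    rw [smul_smul, ← RCLike.ofReal_mul, ← Real.exp_add]
    simp

theorem IsContractive.isExponentiallyStable_rescale {T : C0Semigroup 𝕜 E} (hT : T.IsContractive)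
    {c : ℝ} (hc : 0 < c) : (T.rescale (-c)).IsExponentiallyStable := by
  refine ⟨c, 1, hc, one_pos, fun t => ?_⟩
  change ‖((Real.exp (-c * t) : ℝ) : 𝕜) • T.op t‖ ≤ _
  rw [norm_smul, RCLike.norm_ofReal, abs_of_pos (Real.exp_pos _), one_mul]
  exact mul_le_of_le_one_right (Real.exp_pos _).le (hT t)

end C0Semigroup

/-! ### Dissipativity in Hilbert spaces -/

section Hilbert

variable {𝕜 H : Type*} [RCLike 𝕜] [NormedAddCommGroup H] [InnerProductSpace 𝕜 H]

/-- By Cauchy-Schwarz, `‖x‖² ≤ Re ⟨x - l y, x⟩ ≤ ‖x - l y‖ ‖x‖`. -/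
theorem norm_le_norm_sub_smul_of_re_inner_nonpos {x y : H} (h : RCLike.re (inner 𝕜 y x) ≤ 0)
    {l : ℝ} (hl : 0 < l) : ‖x‖ ≤ ‖x - (l : 𝕜) • y‖ := by
  rcases (norm_nonneg x).eq_or_lt with hx | hx
  · rw [← hx]; exact norm_nonneg _
  have h1 : RCLike.re (inner 𝕜 (x - (l : 𝕜) • y) x) = ‖x‖ ^ 2 - l * RCLike.re (inner 𝕜 y x) := by
    rw [inner_sub_left, inner_smul_left, RCLike.conj_ofReal, _root_.map_sub,
      RCLike.re_ofReal_mul, inner_self_eq_norm_sq]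
  have h2 := re_inner_le_norm (𝕜 := 𝕜) (x - (l : 𝕜) • y) x
  have h3 : l * RCLike.re (inner 𝕜 y x) ≤ 0 := mul_nonpos_of_nonneg_of_nonpos hl.le h
  refine le_of_mul_le_mul_right ?_ hx
  nlinarith

variable [CompleteSpace H] {A : H →ₗ.[𝕜] H}

/-- The map `(x, y) ↦ x - l y` is bounded below on the complete graph, so its range is closed;
`horth` says that its orthogonal complement is trivial. -/
theorem LinearPMap.isMDissipative_of_isClosed (hA : A.IsClosed)
    (hdiss : ∀ x y, (x, y) ∈ A.graph → RCLike.re (inner 𝕜 y x) ≤ 0)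
    (horth : ∀ l : ℝ, 0 < l → ∀ w : H,
      (∀ x y, (x, y) ∈ A.graph → inner 𝕜 (x - (l : 𝕜) • y) w = 0) → w = 0) :
    A.IsMDissipative := by
  refine ⟨fun l hl x y h => norm_le_norm_sub_smul_of_re_inner_nonpos (hdiss x y h) hl,
    fun l hl w => ?_⟩
  let Φ : A.graph →L[𝕜] H :=
    (ContinuousLinearMap.fst 𝕜 H H - (l : 𝕜) • ContinuousLinearMap.snd 𝕜 H H).comp
      A.graph.subtypeL
  have hΦ : ∀ p : A.graph, Φ p = p.1.1 - (l : 𝕜) • p.1.2 := fun p => rfl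
  have hcompl : CompleteSpace A.graph := hA.completeSpace_coe
  -- `‖x‖ ≤ ‖Φ p‖` and `l ‖y‖ ≤ ‖x‖ + ‖Φ p‖ ≤ 2 ‖Φ p‖`; the sum of both constants bounds the max
  -- norm.
  have hanti : AntilipschitzWith (1 + 2 / l).toNNReal Φ := by
    refine Φ.antilipschitz_of_bound fun p => ?_
    have hpos : 0 < 2 / l := by positivity
    rw [Real.coe_toNNReal _ (by positivity)]
    have h1 := norm_le_norm_sub_smul_of_re_inner_nonpos (hdiss p.1.1 p.1.2 p.2) hl
    rw [← hΦ] at h1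
    have h2 : l * ‖p.1.2‖ ≤ 2 * ‖Φ p‖ := by
      have e : (l : 𝕜) • p.1.2 = p.1.1 - Φ p := by rw [hΦ, sub_sub_cancel]
      have h3 := norm_sub_le p.1.1 (Φ p)
      rw [← e, norm_smul, RCLike.norm_ofReal, abs_of_pos hl] at h3
      linarith
    have h4 : ‖p.1.2‖ ≤ 2 / l * ‖Φ p‖ := by
      rw [div_mul_eq_mul_div, le_div_iff₀ hl, mul_comm]; exact h2
    have h5 := norm_nonneg (Φ p)
    change max ‖p.1.1‖ ‖p.1.2‖ ≤ _
    refine max_le ?_ ?_ <;> nlinarith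
  have hcl : _root_.IsClosed (Φ.range : Set H) := hanti.isClosed_range Φ.uniformContinuous
  have hcr : CompleteSpace Φ.range := hcl.completeSpace_coe
  have htop : Φ.range = ⊤ := by
    rw [← Submodule.orthogonal_eq_bot_iff, Submodule.eq_bot_iff]
    exact fun v hv => horth l hl v fun x y h => hv _ ⟨⟨(x, y), h⟩, rfl⟩
  obtain ⟨p, hp⟩ : w ∈ Φ.range := htop ▸ Submodule.mem_top
  exact ⟨p.1.1, p.1.2, p.2, hp⟩

/-- If `w = x - A x` is orthogonal to the domain, pairing it with `x` gives `‖x‖² = Re ⟨A x, x⟩ ≤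
0`, so `x = 0` and `w = 0`. -/
theorem LinearPMap.IsMDissipative.dense_domain (hA : A.IsMDissipative)
    (hdiss : ∀ x y, (x, y) ∈ A.graph → RCLike.re (inner 𝕜 y x) ≤ 0) :
    Dense (A.domain : Set H) := by
  rw [Submodule.dense_iff_topologicalClosure_eq_top, Submodule.topologicalClosure_eq_top_iff,
    Submodule.eq_bot_iff]
  intro w hw
  obtain ⟨x, y, hxy, rfl⟩ := hA.exists_sub_smul_eq 1 one_pos w
  have h1 := hw x (LinearPMap.mem_domain_of_mem_graph hxy)
  have h2 : RCLike.re (inner 𝕜 (x - ((1 : ℝ) : 𝕜) • y) x) = 0 := by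
    rw [inner_eq_zero_symm.1 h1, _root_.map_zero]
  rw [RCLike.ofReal_one, one_smul, inner_sub_left, _root_.map_sub, inner_self_eq_norm_sq] at h2
  have hx : x = 0 := by
    have := hdiss x y hxy
    have : ‖x‖ ^ 2 ≤ 0 := by linarith
    simpa using this
  rw [hx] at hxy ⊢
  rw [A.graph_fst_eq_zero_snd hxy rfl]
  simp

end Hilbert

/-! ### The block operator is m-dissipative -/

section BlockOperator

variable {𝕜 X : Type*} [RCLike 𝕜] [NormedAddCommGroup X] [InnerProductSpace 𝕜 X]
  [CompleteSpace X] {D : X →ₗ.[𝕜] X} {G R : X →L[𝕜] X}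

theorem mem_graph_blockOp {z w : WithLp 2 (X × X)} :
    (z, w) ∈ (blockOp D G R).graph ↔
      (z.fst, w.snd + R z.snd) ∈ D.graph ∧ (z.snd, -(w.fst + G z.fst)) ∈ D.adjoint.graph := by
  rw [LinearPMap.mem_graph_iff, LinearPMap.mem_graph_iff, LinearPMap.mem_graph_iff]
  constructor
  · rintro ⟨z, rfl, rfl⟩
    refine ⟨⟨⟨_, z.2.1⟩, rfl, ?_⟩, ⟨⟨_, z.2.2⟩, rfl, ?_⟩⟩
    · change _ = D ⟨z.1.fst, z.2.1⟩ - R z.1.snd + R z.1.snd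
      rw [sub_add_cancel]
    · change _ = -(-(G z.1.fst) - D.adjoint ⟨z.1.snd, z.2.2⟩ + G z.1.fst)
      abel_nf
  · rintro ⟨⟨x, hx, hx'⟩, ⟨y, hy, hy'⟩⟩
    dsimp only at hx hx' hy hy'
    have h1 : z.fst ∈ D.domain := hx ▸ x.2
    have h2 : z.snd ∈ D.adjoint.domain := hy ▸ y.2
    refine ⟨⟨z, h1, h2⟩, rfl, ?_⟩
    have hx1 : x = ⟨z.fst, h1⟩ := Subtype.ext hx
    have hy1 : y = ⟨z.snd, h2⟩ := Subtype.ext hy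
    subst hx1 hy1
    change WithLp.toLp 2 (-(G z.fst) - D.adjoint ⟨z.snd, h2⟩, D ⟨z.fst, h1⟩ - R z.snd) = w
    rw [hx', hy']
    apply WithLp.ofLp_injective
    ext
    · change -(G z.fst) - -(w.fst + G z.fst) = w.fst
      abel
    · change w.snd + R z.snd - R z.snd = w.snd
      abel

theorem inner_eq_inner_of_mem_graph (hD : Dense (D.domain : Set X)) {x x' y y' : X}
    (hx : (x, x') ∈ D.graph) (hy : (y, y') ∈ D.adjoint.graph) :
    inner 𝕜 x' y = inner 𝕜 x y' := by
  rw [LinearPMap.adjoint_graph_eq_graph_adjoint hD, Submodule.mem_adjoint_iff] at hy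
  exact sub_eq_zero.1 (hy x x' hx)

theorem mem_adjoint_graph_of_forall_inner (hD : Dense (D.domain : Set X)) {y y' : X}
    (h : ∀ x x', (x, x') ∈ D.graph → inner 𝕜 x' y = inner 𝕜 x y') :
    (y, y') ∈ D.adjoint.graph := by
  rw [LinearPMap.adjoint_graph_eq_graph_adjoint hD, Submodule.mem_adjoint_iff]
  exact fun x x' hx => sub_eq_zero.2 (h x x' hx)

/-- A closed densely defined operator coincides with its second adjoint. -/
theorem mem_graph_of_forall_inner_adjoint (hDc : D.IsClosed) (hD : Dense (D.domain : Set X))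
    {x x' : X} (h : ∀ y y', (y, y') ∈ D.adjoint.graph → inner 𝕜 x' y = inner 𝕜 x y') :
    (x, x') ∈ D.graph := by
  -- The graph is moved to the Hilbert product, where a closed subspace equals its double orthogonal
  -- complement. Orthogonality of `v` to it says that `(v.snd, -v.fst)` is in the graph of `D*`.
  let K : Submodule 𝕜 (WithLp 2 (X × X)) :=
    D.graph.comap (WithLp.linearEquiv 2 𝕜 (X × X)).toLinearMap
  have hK : IsClosed (K : Set (WithLp 2 (X × X))) :=
    IsClosed.preimage (WithLp.prod_continuous_ofLp 2 X X) hDc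
  have hKc : CompleteSpace K := hK.completeSpace_coe
  suffices hmem : WithLp.toLp 2 (x, x') ∈ Kᗮᗮ by
    rw [Submodule.orthogonal_orthogonal] at hmem
    exact hmem
  intro v hv
  have h1 : (v.snd, -v.fst) ∈ D.adjoint.graph := by
    refine mem_adjoint_graph_of_forall_inner hD fun a a' ha => ?_
    have h2 := hv (WithLp.toLp 2 (a, a')) ha
    rw [WithLp.prod_inner_apply] at h2
    rw [inner_neg_right]
    exact eq_neg_of_add_eq_zero_right h2
  have h3 := h _ _ h1
  rw [inner_neg_right] at h3
  rw [inner_eq_zero_symm, WithLp.prod_inner_apply]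
  change inner 𝕜 x v.fst + inner 𝕜 x' v.snd = 0
  rw [h3, add_neg_cancel]

theorem isClosed_blockOp (hDc : D.IsClosed) (hD : Dense (D.domain : Set X)) :
    (blockOp D G R).IsClosed := by
  have h1 : IsClosed {p : WithLp 2 (X × X) × WithLp 2 (X × X) |
      (p.1.fst, p.2.snd + R p.1.snd) ∈ D.graph} :=
    IsClosed.preimage (f := fun p : WithLp 2 (X × X) × WithLp 2 (X × X) =>
      (p.1.fst, p.2.snd + R p.1.snd)) (by fun_prop) hDc
  have h2 : IsClosed {p : WithLp 2 (X × X) × WithLp 2 (X × X) |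
      (p.1.snd, -(p.2.fst + G p.1.fst)) ∈ D.adjoint.graph} :=
    IsClosed.preimage (f := fun p : WithLp 2 (X × X) × WithLp 2 (X × X) =>
      (p.1.snd, -(p.2.fst + G p.1.fst))) (by fun_prop) (LinearPMap.adjoint_isClosed hD)
  rw [LinearPMap.IsClosed]
  convert! h1.inter h2 using 1
  ext p
  exact mem_graph_blockOp

/-- The terms with `D` and `D*` cancel, leaving `-Re ⟨G z₁, z₁⟩ - Re ⟨R z₂, z₂⟩`. -/
theorem re_inner_blockOp_nonpos (hD : Dense (D.domain : Set X))
    (hG : ∀ x, 0 ≤ RCLike.re (inner 𝕜 (G x) x)) (hR : ∀ x, 0 ≤ RCLike.re (inner 𝕜 (R x) x))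
    {z w : WithLp 2 (X × X)} (h : (z, w) ∈ (blockOp D G R).graph) :
    RCLike.re (inner 𝕜 w z) ≤ 0 := by
  obtain ⟨h1, h2⟩ := mem_graph_blockOp.1 h
  have h3 := congrArg RCLike.re (inner_eq_inner_of_mem_graph hD h1 h2)
  rw [inner_add_left, inner_neg_right, inner_add_right, _root_.map_add, _root_.map_neg,
    _root_.map_add, inner_re_symm z.fst, inner_re_symm z.fst] at h3
  rw [WithLp.prod_inner_apply, _root_.map_add]
  have h4 := hG z.fst
  have h5 := hR z.snd
  change RCLike.re (inner 𝕜 w.fst z.fst) + RCLike.re (inner 𝕜 w.snd z.snd) ≤ 0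
  linarith

/-- Testing with `(x, 0)` and `(0, y)` gives `D* v₂ = l⁻¹ v₁ + G* v₁` and `D v₁ = -(l⁻¹ v₂ + R*
v₂)`. Inserted in `⟨D v₁, v₂⟩ = ⟨v₁, D* v₂⟩`, they equate a nonpositive real part with a nonnegative
one, so `v₁` and `v₂` vanish. -/
theorem eq_zero_of_inner_sub_smul_blockOp (hDc : D.IsClosed) (hD : Dense (D.domain : Set X))
    (hG : ∀ x, 0 ≤ RCLike.re (inner 𝕜 (G x) x)) (hR : ∀ x, 0 ≤ RCLike.re (inner 𝕜 (R x) x))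
    {l : ℝ} (hl : 0 < l) {v : WithLp 2 (X × X)}
    (hv : ∀ z w, (z, w) ∈ (blockOp D G R).graph → inner 𝕜 (z - (l : 𝕜) • w) v = 0) : v = 0 := by
  have hl' : (l : 𝕜) ≠ 0 := RCLike.ofReal_ne_zero.2 hl.ne'
  have h1 : (v.snd, ((l⁻¹ : ℝ) : 𝕜) • v.fst + G.adjoint v.fst) ∈ D.adjoint.graph := by
    refine mem_adjoint_graph_of_forall_inner hD fun x x' hx => ?_
    have h := hv (WithLp.toLp 2 (x, 0)) (WithLp.toLp 2 (-G x, x'))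
      (mem_graph_blockOp.2 (by simpa using! hx))
    rw [WithLp.prod_inner_apply] at h
    change inner 𝕜 (x - (l : 𝕜) • -G x) v.fst + inner 𝕜 (0 - (l : 𝕜) • x') v.snd = 0 at h
    rw [zero_sub, smul_neg, sub_neg_eq_add, inner_add_left, inner_neg_left, inner_smul_left,
      inner_smul_left, RCLike.conj_ofReal] at h
    rw [inner_add_right, inner_smul_right, ContinuousLinearMap.adjoint_inner_right,
      RCLike.ofReal_inv]
    field_simp
    linear_combination -h
  have h2 : (v.fst, -(((l⁻¹ : ℝ) : 𝕜) • v.snd + R.adjoint v.snd)) ∈ D.graph := by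
    refine mem_graph_of_forall_inner_adjoint hDc hD fun y y' hy => ?_
    have h := hv (WithLp.toLp 2 (0, y)) (WithLp.toLp 2 (-y', -R y))
      (mem_graph_blockOp.2 (by simpa using! hy))
    rw [WithLp.prod_inner_apply] at h
    change inner 𝕜 (0 - (l : 𝕜) • -y') v.fst + inner 𝕜 (y - (l : 𝕜) • -R y) v.snd = 0 at h
    rw [zero_sub, smul_neg, neg_neg, smul_neg, sub_neg_eq_add, inner_add_left, inner_smul_left,
      inner_smul_left, RCLike.conj_ofReal] at h
    have h' : inner 𝕜 y (-(((l⁻¹ : ℝ) : 𝕜) • v.snd + R.adjoint v.snd)) = inner 𝕜 y' v.fst := by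
      rw [inner_neg_right, inner_add_right, inner_smul_right,
        ContinuousLinearMap.adjoint_inner_right, RCLike.ofReal_inv]
      field_simp
      linear_combination -h
    rw [← inner_conj_symm, h', inner_conj_symm]
  have h3 := congrArg RCLike.re (inner_eq_inner_of_mem_graph hD h2 h1)
  rw [inner_neg_left, inner_add_left, inner_add_right, inner_smul_left, inner_smul_right,
    RCLike.conj_ofReal, ContinuousLinearMap.adjoint_inner_left,
    ContinuousLinearMap.adjoint_inner_right, _root_.map_neg, _root_.map_add, _root_.map_add,
    RCLike.re_ofReal_mul, RCLike.re_ofReal_mul, inner_self_eq_norm_sq, inner_self_eq_norm_sq,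
    inner_re_symm v.snd] at h3
  have h4 := hG v.fst
  have h5 := hR v.snd
  have hl2 : 0 < l⁻¹ := inv_pos.2 hl
  have h6 : l⁻¹ * ‖v.fst‖ ^ 2 ≥ 0 := by positivity
  have h7 : l⁻¹ * ‖v.snd‖ ^ 2 ≥ 0 := by positivity
  have h8 : l⁻¹ * ‖v.fst‖ ^ 2 = 0 := by linarith
  have h9 : l⁻¹ * ‖v.snd‖ ^ 2 = 0 := by linarith
  have e1 : v.fst = 0 := by simpa [hl.ne'] using h8
  have e2 : v.snd = 0 := by simpa [hl.ne'] using h9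
  apply WithLp.ofLp_injective
  ext
  · exact e1
  · exact e2

theorem isMDissipative_blockOp (hDc : D.IsClosed) (hD : Dense (D.domain : Set X))
    (hG : ∀ x, 0 ≤ RCLike.re (inner 𝕜 (G x) x)) (hR : ∀ x, 0 ≤ RCLike.re (inner 𝕜 (R x) x)) :
    (blockOp D G R).IsMDissipative :=
  LinearPMap.isMDissipative_of_isClosed (isClosed_blockOp hDc hD)
    (fun _ _ h => re_inner_blockOp_nonpos hD hG hR h)
    (fun _ hl _ hv => eq_zero_of_inner_sub_smul_blockOp hDc hD hG hR hl hv)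

theorem dense_domain_blockOp (hDc : D.IsClosed) (hD : Dense (D.domain : Set X))
    (hG : ∀ x, 0 ≤ RCLike.re (inner 𝕜 (G x) x)) (hR : ∀ x, 0 ≤ RCLike.re (inner 𝕜 (R x) x)) :
    Dense ((blockOp D G R).domain : Set (WithLp 2 (X × X))) :=
  (isMDissipative_blockOp hDc hD hG hR).dense_domain
    fun _ _ h => re_inner_blockOp_nonpos hD hG hR h

theorem exists_contractive_isGeneratedBy_blockOp (hDc : D.IsClosed)
    (hD : Dense (D.domain : Set X)) (hG : ∀ x, 0 ≤ RCLike.re (inner 𝕜 (G x) x))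
    (hR : ∀ x, 0 ≤ RCLike.re (inner 𝕜 (R x) x)) :
    ∃ T : C0Semigroup 𝕜 (WithLp 2 (X × X)), T.IsGeneratedBy (blockOp D G R) ∧ T.IsContractive :=
  (isMDissipative_blockOp hDc hD hG hR).exists_isGeneratedBy
    (dense_domain_blockOp hDc hD hG hR)

end BlockOperator

/-! ### Shifts, reflections and the three cases -/

section Positivity

variable {𝕜 X : Type*} [RCLike 𝕜] [NormedAddCommGroup X] [InnerProductSpace 𝕜 X]

theorem IsNonnegOp.re_inner_nonneg {P : X →L[𝕜] X} (hP : IsNonnegOp P) (x : X) :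
    0 ≤ RCLike.re (inner 𝕜 (P x) x) :=
  (RCLike.nonneg_iff.1 (hP x)).1

theorem re_inner_sub_smul_one_nonneg {P : X →L[𝕜] X} {c d : ℝ} (hcd : c ≤ d)
    (hP : ∀ x : X, ((d * ‖x‖ ^ 2 : ℝ) : 𝕜) ≤ inner 𝕜 (P x) x) (x : X) :
    0 ≤ RCLike.re (inner 𝕜 ((P - (c : 𝕜) • 1) x) x) := by
  have h1 := (RCLike.le_iff_re_im.1 (hP x)).1
  rw [RCLike.ofReal_re] at h1
  change 0 ≤ RCLike.re (inner 𝕜 (P x - (c : 𝕜) • x) x)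
  rw [inner_sub_left, inner_smul_left, RCLike.conj_ofReal, _root_.map_sub, RCLike.re_ofReal_mul,
    inner_self_eq_norm_sq]
  have h2 := mul_le_mul_of_nonneg_right hcd (sq_nonneg ‖x‖)
  linarith

end Positivity

section Reflection

variable {𝕜 E : Type*} [RCLike 𝕜] [NormedAddCommGroup E] [NormedSpace 𝕜 E] {A : E →ₗ.[𝕜] E}

theorem LinearPMap.mem_graph_neg_iff {x y : E} : (x, y) ∈ (-A).graph ↔ (x, -y) ∈ A.graph := by
  rw [LinearPMap.mem_graph_iff, LinearPMap.mem_graph_iff]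
  refine exists_congr fun z => and_congr_right fun _ => ?_
  change -(A z) = y ↔ A z = -y
  exact neg_eq_iff_eq_neg

/-- If an isometric involution `J` intertwines `A` and `-A`, then `-A` is m-dissipative when
`A` is. -/
theorem LinearPMap.IsMDissipative.neg_of_reflection (hA : A.IsMDissipative) (J : E →ₗ[𝕜] E)
    (hJ : ∀ x, ‖J x‖ = ‖x‖) (hJJ : ∀ x, J (J x) = x)
    (hJA : ∀ x y, (x, y) ∈ A.graph → (J x, -J y) ∈ A.graph) : (-A).IsMDissipative := by
  refine ⟨fun l hl x y h => ?_, fun l hl w => ?_⟩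
  · have h1 := hJA _ _ (LinearPMap.mem_graph_neg_iff.1 h)
    rw [_root_.map_neg, neg_neg] at h1
    have h2 := hA.norm_le l hl _ _ h1
    rwa [← _root_.map_smul, ← _root_.map_sub, hJ, hJ] at h2
  · obtain ⟨x, y, h, e⟩ := hA.exists_sub_smul_eq l hl (J w)
    refine ⟨J x, J y, LinearPMap.mem_graph_neg_iff.2 (hJA x y h), ?_⟩
    rw [← _root_.map_smul, ← _root_.map_sub, e, hJJ]

end Reflection

section BlockOperator

variable {𝕜 X : Type*} [RCLike 𝕜] [NormedAddCommGroup X] [InnerProductSpace 𝕜 X]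
  [CompleteSpace X] {D : X →ₗ.[𝕜] X} {G R : X →L[𝕜] X}

theorem isMDissipative_neg_blockOp_zero (hDc : D.IsClosed) (hD : Dense (D.domain : Set X)) :
    (-blockOp D 0 0).IsMDissipative := by
  -- Conjugation by this reflection negates the off-diagonal blocks, which is all of `A` when `G = R
  -- = 0`.
  let J : WithLp 2 (X × X) →ₗ[𝕜] WithLp 2 (X × X) :=
    { toFun z := WithLp.toLp 2 (z.fst, -z.snd)
      map_add' a b := by
        apply WithLp.ofLp_injective
        ext
        · rfl
        · exact neg_add _ _
      map_smul' c a := by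
        apply WithLp.ofLp_injective
        ext
        · rfl
        · exact (smul_neg _ _).symm }
  refine (isMDissipative_blockOp hDc hD (by simp) (by simp)).neg_of_reflection J (fun z => ?_)
    (fun z => ?_) (fun z w h => ?_)
  · rw [WithLp.prod_norm_eq_of_L2, WithLp.prod_norm_eq_of_L2]
    change √(‖z.fst‖ ^ 2 + ‖-z.snd‖ ^ 2) = _
    rw [norm_neg]
  · apply WithLp.ofLp_injective
    ext
    · rfl
    · exact neg_neg _
  · obtain ⟨h1, h2⟩ := mem_graph_blockOp.1 h
    simp only [zero_apply, add_zero] at h1 h2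
    refine mem_graph_blockOp.2 ⟨?_, ?_⟩
    · simp only [zero_apply, add_zero]
      change (z.fst, - -w.snd) ∈ D.graph
      rwa [neg_neg]
    · simp only [zero_apply, add_zero]
      change (-z.snd, - -w.fst) ∈ D.adjoint.graph
      exact D.adjoint.graph.neg_mem h2

theorem exists_unitary_isGeneratedBy_blockOp_zero (hDc : D.IsClosed)
    (hD : Dense (D.domain : Set X)) :
    ∃ T : C0Semigroup 𝕜 (WithLp 2 (X × X)), T.IsGeneratedBy (blockOp D 0 0) ∧ T.IsUnitary := by
  have hd := dense_domain_blockOp hDc hD (G := 0) (R := 0) (by simp) (by simp)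
  obtain ⟨T, hT, hTc⟩ := exists_contractive_isGeneratedBy_blockOp hDc hD (G := 0) (R := 0)
    (by simp) (by simp)
  -- `hd` serves here too, since negation keeps the domain.
  obtain ⟨S, hS, hSc⟩ := (isMDissipative_neg_blockOp_zero hDc hD).exists_isGeneratedBy hd
  exact ⟨T, hT, C0Semigroup.isUnitary_of_neg hTc hSc hT hS
    (fun _ _ => LinearPMap.mem_graph_neg_iff) hd⟩

theorem mem_graph_blockOp_sub_smul_one {c : 𝕜} {z w : WithLp 2 (X × X)} :
    (z, w) ∈ (blockOp D G R).graph ↔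
      (z, w + c • z) ∈ (blockOp D (G - c • 1) (R - c • 1)).graph := by
  rw [mem_graph_blockOp, mem_graph_blockOp]
  have h1 : (w + c • z).snd + (R - c • 1) z.snd = w.snd + R z.snd := by
    change w.snd + c • z.snd + (R z.snd - c • z.snd) = _
    abel
  have h2 : (w + c • z).fst + (G - c • 1) z.fst = w.fst + G z.fst := by
    change w.fst + c • z.fst + (G z.fst - c • z.fst) = _
    abel
  rw [h1, h2]

theorem exists_exponentiallyStable_isGeneratedBy_blockOp (hDc : D.IsClosed)
    (hD : Dense (D.domain : Set X)) (hG : IsUniformlyPositiveOp G)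
    (hR : IsUniformlyPositiveOp R) :
    ∃ T : C0Semigroup 𝕜 (WithLp 2 (X × X)),
      T.IsGeneratedBy (blockOp D G R) ∧ T.IsExponentiallyStable := by
  obtain ⟨g, hg, hG⟩ := hG
  obtain ⟨r, hr, hR⟩ := hR
  -- The minimum `min g r` is a shift that keeps both diagonal blocks nonnegative.
  obtain ⟨T, hT, hTc⟩ := exists_contractive_isGeneratedBy_blockOp hDc hD
    (re_inner_sub_smul_one_nonneg (min_le_left g r) hG)
    (re_inner_sub_smul_one_nonneg (min_le_right g r) hR)
  refine ⟨T.rescale (-min g r), hT.rescale _ fun z w => ?_,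
    hTc.isExponentiallyStable_rescale (lt_min hg hr)⟩
  rw [RCLike.ofReal_neg, neg_smul, sub_neg_eq_add]
  exact mem_graph_blockOp_sub_smul_one

end BlockOperator

theorem proposition2p3 {𝕜 X : Type*} [RCLike 𝕜] [NormedAddCommGroup X] [InnerProductSpace 𝕜 X]
    [CompleteSpace X] (D : X →ₗ.[𝕜] X) (hDclosed : D.IsClosed)
    (hDdense : Dense (D.domain : Set X)) (G R : X →L[𝕜] X) :
    (R = 0 ∧ G = 0 →
      ∃ T : C0Semigroup 𝕜 (WithLp 2 (X × X)),
        T.IsGeneratedBy (blockOp D G R) ∧ T.IsUnitary) ∧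
    (IsNonnegOp G ∧ IsNonnegOp R →
      ∃ T : C0Semigroup 𝕜 (WithLp 2 (X × X)),
        T.IsGeneratedBy (blockOp D G R) ∧ T.IsContractive) ∧
    (IsUniformlyPositiveOp R ∧ IsUniformlyPositiveOp G →
      ∃ T : C0Semigroup 𝕜 (WithLp 2 (X × X)),
        T.IsGeneratedBy (blockOp D G R) ∧ T.IsExponentiallyStable) := by
  refine ⟨?_, ?_, ?_⟩
  · rintro ⟨rfl, rfl⟩
    exact exists_unitary_isGeneratedBy_blockOp_zero hDclosed hDdense
  · rintro ⟨hG, hR⟩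
    exact exists_contractive_isGeneratedBy_blockOp hDclosed hDdense hG.re_inner_nonneg
      hR.re_inner_nonneg
  · rintro ⟨hR, hG⟩
    exact exists_exponentiallyStable_isGeneratedBy_blockOp hDclosed hDdense hG hR
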